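/- Let $\mathcal H$ be a finite-dimensional complex Hilbert space and let $\mathcal B(\mathcal H)^{++}$ be the set of positive definite (positive semidefinite and invertible) operators on $\mathcal H$. Let $\mu$ be a Borel probability measure on $[0,1]$ with $\mu((0,1))>0$, let $c(\mu)=\int_{[0,1]}\lambda\,d\mu(\lambda)$ be its center of mass, and let $f_\mu(x)=\int_{[0,1]}\frac{x}{(1-\lambda)x+\lambda}\,d\mu(\lambda)$ for $x>0$. For $A,B\in\mathcal B(\mathcal H)^{++}$ put $A\,\sigma_{f_\mu}B=A^{1/2}f_\mu(A^{-1/2}BA^{-1/2})A^{1/2}$ and let $$\phi_\mu(A,B)=\operatorname{tr}\big((1-c(\mu))A+c(\mu)B-A\,\sigma_{f_\mu}B\big)$$ be the generalized quantum Hellinger divergence. Let $A_1,\dots,A_m\in\mathcal B(\mathcal H)^{++}$ and let $w_1,\dots,w_m>0$ with $\sum_{j=1}^m w_j=1$. Then the function $X\mapsto\sum_{j=1}^m w_j\,\phi_\mu(A_j,X)$ has exactly one minimizer on $\mathcal B(\mathcal H)^{++}$, the equation $$X=\frac1{c(\mu)}\sum_{j=1}^m w_j\int_{[0,1]}\lambda\,\big|(1-\lambda)A_j^{-1}X^{1/2}+\lambda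 X^{-1/2}\big|^{-2}\,d\mu(\lambda)$$ has exactly one solution $X\in\mathcal B(\mathcal H)^{++}$, and the minimizer and the solution coincide. Here $|Z|=(Z^*Z)^{1/2}$. -/

import Mathlib

noncomputable section

namespace Hellinger

open MeasureTheory

/-- The center of mass `c(μ) = ∫ λ dμ(λ)` of a Borel measure on `[0,1]`. -/
def centerOfMass (μ : Measure unitInterval) : ℝ :=
  ∫ l : unitInterval, (l : ℝ) ∂μ

/-- The function `f_μ(x) = ∫ x / ((1-λ) x + λ) dμ(λ)`, used for `x > 0`. -/
def genFun (μ : Measure unitInterval) (x : ℝ) : ℝ :=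
  ∫ l : unitInterval, x / ((1 - (l : ℝ)) * x + (l : ℝ)) ∂μ

variable {H : Type*} [NormedAddCommGroup H] [InnerProductSpace ℂ H] [CompleteSpace H]

/-- `A σ_f B = A^{1/2} f(A^{-1/2} B A^{-1/2}) A^{1/2}`, used for positive definite `A`, `B`. -/
def kuboAndo (f : ℝ → ℝ) (A B : H →L[ℂ] H) : H →L[ℂ] H :=
  CFC.sqrt A * cfc f (Ring.inverse (CFC.sqrt A) * B * Ring.inverse (CFC.sqrt A)) * CFC.sqrt A

/-- The generalized quantum Hellinger divergence
`φ_μ(A,B) = tr((1 - c(μ)) A + c(μ) B - A σ_{f_μ} B)`. The trace is a real number for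
self-adjoint `A`, `B`; its real part is taken to land in `ℝ`. -/
def divergence (μ : Measure unitInterval) (A B : H →L[ℂ] H) : ℝ :=
  (LinearMap.trace ℂ H
    (((1 - centerOfMass μ) • A + centerOfMass μ • B - kuboAndo (genFun μ) A B : H →L[ℂ] H) :
      H →ₗ[ℂ] H)).re

/-- The set of minimizers of `X ↦ ∑ j, w j * φ_μ(A j, X)` over the positive definite
(positive semidefinite and invertible) operators. -/
def barycenters (μ : Measure unitInterval) {m : ℕ} (A : Fin m → H →L[ℂ] H) (w : Fin m → ℝ) :
    Set (H →L[ℂ] H) :=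
  {X | IsStrictlyPositive X ∧
    IsMinOn (fun Y : H →L[ℂ] H => ∑ j, w j * divergence μ (A j) Y)
      {Y | IsStrictlyPositive Y} X}

/-- The operator
`(1/c(μ)) ∑ j, w j ∫ λ |(1-λ) (A j)^{-1} X^{1/2} + λ X^{-1/2}|^{-2} dμ(λ)`. -/
def fixedPointMap (μ : Measure unitInterval) {m : ℕ} (A : Fin m → H →L[ℂ] H) (w : Fin m → ℝ)
    (X : H →L[ℂ] H) : H →L[ℂ] H :=
  (1 / centerOfMass μ) • ∑ j, w j • ∫ l : unitInterval,
    (l : ℝ) • Ring.inverse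
      (CFC.abs ((1 - (l : ℝ)) • (Ring.inverse (A j) * CFC.sqrt X)
        + (l : ℝ) • Ring.inverse (CFC.sqrt X)) ^ 2) ∂μ

end Hellinger

end

noncomputable section

namespace Hellinger

open MeasureTheory

set_option linter.unusedSectionVars false

/-! The kernel `x / ((1 - λ) x + λ)` generates the weighted harmonic mean, so `A σ X` is the average
over `μ` of `X T⁻¹ A` with `T = λ A + (1 - λ) X`. The resolvent identity expands this in `X` to
second order with no truncation: `φ_μ(A, Y) - φ_μ(A, X)` is a linear term `tr(∇ (Y - X))` plus `∫ λ
(1 - λ) r dμ`, where `r` is a squared Hilbert–Schmidt norm that vanishes only for `Y = X`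
(`divergence_expansion`, `remainderKernel_eq`). As `μ` charges the open interval, a zero of the
total gradient `G` is a strict global minimizer, hence unique.

The fixed-point equation is the critical equation in disguise: its right side equals `X - c⁻¹
X^{1/2} G(X) X^{1/2}` (`fixedPointMap_eq`), and `X^{1/2}` is invertible.

It remains to find a zero of `G`. The objective attains a minimum on the compact order interval `[ε,
K]`, with `ε` below and `K` above the spectra of all `A j`. If `ε` were an eigenvalue of the
minimizer, raising it would decrease the objective; if `K` were one, lowering it would
(`reTrace_gradient_bottom_neg`, `reTrace_gradient_top_pos`). So the minimizer is interior, and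
moving along `-G` gives `tr G² ≤ 0`, that is `G = 0`. -/

variable {H : Type*} [NormedAddCommGroup H] [InnerProductSpace ℂ H] [CompleteSpace H]

/-! ### Order bounds, inverses and eigenvectors of positive operators -/

section Operators

theorem mul_norm_sq_le_re_inner {ε : ℝ} {X : H →L[ℂ] H} (h : ε • (1 : H →L[ℂ] H) ≤ X) (v : H) :
    ε * ‖v‖ ^ 2 ≤ (inner ℂ (X v) v).re := by
  have := (((ContinuousLinearMap.le_def _ _).1 h).re_inner_nonneg_left v)
  simp only [sub_apply, smul_apply,
    one_apply_eq_self, inner_sub_left, map_sub, inner_smul_left_eq_smul,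
    RCLike.smul_re, inner_self_eq_norm_sq, sub_nonneg] at this
  simpa using this

theorem mul_norm_le_norm_apply {ε : ℝ} {X : H →L[ℂ] H} (h : ε • (1 : H →L[ℂ] H) ≤ X) (v : H) :
    ε * ‖v‖ ≤ ‖X v‖ := by
  rcases eq_or_ne v 0 with rfl | hv
  · simp
  have hv' : 0 < ‖v‖ := norm_pos_iff.2 hv
  have h1 := mul_norm_sq_le_re_inner h v
  have h2 : (inner ℂ (X v) v).re ≤ ‖X v‖ * ‖v‖ := re_inner_le_norm (𝕜 := ℂ) _ _
  nlinarith

theorem isStrictlyPositive_smul_one {ε : ℝ} (hε : 0 < ε) :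
    IsStrictlyPositive (ε • (1 : H →L[ℂ] H)) :=
  IsStrictlyPositive.smul hε isStrictlyPositive_one

theorem isStrictlyPositive_of_smul_one_le {ε : ℝ} (hε : 0 < ε) {X : H →L[ℂ] H}
    (h : ε • (1 : H →L[ℂ] H) ≤ X) : IsStrictlyPositive X :=
  (isStrictlyPositive_smul_one hε).of_le h

theorem inverse_apply_apply {X : H →L[ℂ] H} (hX : IsUnit X) (v : H) :
    X (Ring.inverse X v) = v := by
  rw [← mul_apply_eq_comp, Ring.mul_inverse_cancel _ hX, one_apply_eq_self]

theorem norm_inverse_apply_le {ε : ℝ} (hε : 0 < ε) {X : H →L[ℂ] H}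
    (h : ε • (1 : H →L[ℂ] H) ≤ X) (v : H) : ‖Ring.inverse X v‖ ≤ ε⁻¹ * ‖v‖ := by
  have h1 := mul_norm_le_norm_apply h (Ring.inverse X v)
  rw [inverse_apply_apply (isStrictlyPositive_of_smul_one_le hε h).isUnit] at h1
  rw [inv_mul_eq_div, le_div_iff₀ hε]
  linarith

theorem norm_inverse_le {ε : ℝ} (hε : 0 < ε) {X : H →L[ℂ] H}
    (h : ε • (1 : H →L[ℂ] H) ≤ X) : ‖Ring.inverse X‖ ≤ ε⁻¹ :=
  ContinuousLinearMap.opNorm_le_bound _ (by positivity) (norm_inverse_apply_le hε h)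

theorem inverse_eq_of_mul_eq_one {a b : H →L[ℂ] H} (h : a * b = 1) (h' : b * a = 1) :
    Ring.inverse a = b :=
  Ring.inverse_unit ⟨a, b, h, h'⟩

theorem inverse_smul_one {K : ℝ} (hK : K ≠ 0) :
    Ring.inverse (K • (1 : H →L[ℂ] H)) = K⁻¹ • (1 : H →L[ℂ] H) :=
  inverse_eq_of_mul_eq_one (by simp [smul_smul, hK]) (by simp [smul_smul, hK])

theorem smul_one_le_inverse {K : ℝ} (hK : 0 < K) {X : H →L[ℂ] H} (hX : IsStrictlyPositive X)
    (h : X ≤ K • (1 : H →L[ℂ] H)) : K⁻¹ • (1 : H →L[ℂ] H) ≤ Ring.inverse X := by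
  rw [← inverse_smul_one hK.ne']
  exact CStarAlgebra.ringInverse_le_ringInverse h hX

theorem le_norm_smul_one {X : H →L[ℂ] H} (hX : IsSelfAdjoint X) :
    X ≤ ‖X‖ • (1 : H →L[ℂ] H) := by
  rw [← Algebra.algebraMap_eq_smul_one]
  exact hX.le_algebraMap_norm_self

theorem smul_one_le_smul_one {a b : ℝ} (h : a ≤ b) :
    a • (1 : H →L[ℂ] H) ≤ b • (1 : H →L[ℂ] H) :=
  smul_le_smul_of_nonneg_right h zero_le_one

/-- Inversion reverses the order, so an upper bound on `X⁻¹` by its norm becomes a lower bound on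
`X`. Adding 1 keeps the constant positive even when `H` is trivial. -/
theorem exists_smul_one_le {X : H →L[ℂ] H} (hX : IsStrictlyPositive X) :
    ∃ ε : ℝ, 0 < ε ∧ ε • (1 : H →L[ℂ] H) ≤ X := by
  have hK : 0 < ‖Ring.inverse X‖ + 1 := by positivity
  refine ⟨(‖Ring.inverse X‖ + 1)⁻¹, by positivity, ?_⟩
  have h := smul_one_le_inverse hK hX.ringInverse
    ((le_norm_smul_one hX.ringInverse.isSelfAdjoint).trans (smul_one_le_smul_one (by linarith)))
  rwa [Ring.inverse_inverse hX.isUnit] at h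

/-- An eigenvector of a nonnegative operator splits off a multiple of its projection. -/
theorem smul_rankOne_le {B : H →L[ℂ] H} (hB : 0 ≤ B) {s : ℝ} {v : H} (hv : ‖v‖ = 1)
    (h : B v = s • v) : s • InnerProductSpace.rankOne ℂ v v ≤ B := by
  set P := InnerProductSpace.rankOne ℂ v v with hP
  have hBs : IsSelfAdjoint B := hB.isSelfAdjoint
  have hPs : IsSelfAdjoint P :=
    ((ContinuousLinearMap.nonneg_iff_isPositive _).2
      (InnerProductSpace.isPositive_rankOne_self v)).isSelfAdjoint
  have hBP : B * P = s • P := by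
    ext x
    simp only [hP, mul_apply_eq_comp, smul_apply, InnerProductSpace.rankOne_apply, map_smul, h]
    exact smul_comm _ _ _
  have hPB : P * B = s • P := by
    have := congrArg star hBP
    simpa [hBs.star_eq, hPs.star_eq] using this
  have hPP : P * P = P := by
    ext x
    simp [hP, hv]
  -- `P` is a projection with `B P = P B = s P`, so compressing `B` by `1 - P` removes exactly `s
  -- P`.
  have key : B - s • P = star (1 - P) * B * (1 - P) := by
    rw [star_sub, star_one, hPs.star_eq, sub_mul, one_mul, hPB, mul_sub, mul_one, sub_mul, hBP,
      smul_mul_assoc, hPP]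
    abel
  rw [← sub_nonneg, key]
  exact star_left_conjugate_nonneg hB _

theorem exists_unit_eigenvector [FiniteDimensional ℂ H] {B : H →L[ℂ] H} (hB : ¬ IsUnit B) :
    ∃ v : H, ‖v‖ = 1 ∧ B v = 0 := by
  have hk : LinearMap.ker (B : H →ₗ[ℂ] H) ≠ ⊥ := by
    intro hk
    apply hB
    rw [ContinuousLinearMap.isUnit_iff_bijective]
    have hi : Function.Injective (B : H →ₗ[ℂ] H) := LinearMap.ker_eq_bot.1 hk
    exact ⟨hi, LinearMap.injective_iff_surjective.1 hi⟩
  obtain ⟨x, hx, hx0⟩ := (Submodule.ne_bot_iff _).1 hk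
  refine ⟨((‖x‖⁻¹ : ℝ) : ℂ) • x, ?_, ?_⟩
  · rw [norm_smul]
    simp [hx0]
  · have : B x = 0 := hx
    simp [this]

end Operators

/-! ### The real trace and the Hilbert–Schmidt norm -/

section Trace

variable [FiniteDimensional ℂ H]

variable (H) in
/-- The real part of the trace, as a continuous real-linear functional. -/
def reTrace : (H →L[ℂ] H) →L[ℝ] ℝ :=
  Complex.reCLM.comp ((LinearMap.toContinuousLinearMap
    ((LinearMap.trace ℂ H).comp (ContinuousLinearMap.coeLM ℂ))).restrictScalars ℝ)

theorem reTrace_apply (B : H →L[ℂ] H) :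
    reTrace H B = (LinearMap.trace ℂ H (B : H →ₗ[ℂ] H)).re := rfl

theorem reTrace_mul_comm (B C : H →L[ℂ] H) : reTrace H (B * C) = reTrace H (C * B) := by
  rw [reTrace_apply, reTrace_apply]
  exact congrArg _ (LinearMap.trace_mul_comm ℂ (B : H →ₗ[ℂ] H) C)

theorem reTrace_star_mul_self (B : H →L[ℂ] H) :
    reTrace H (star B * B) = ∑ i, ‖B (stdOrthonormalBasis ℂ H i)‖ ^ 2 := by
  rw [reTrace_apply, LinearMap.trace_eq_sum_inner _ (stdOrthonormalBasis ℂ H), Complex.re_sum]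
  refine Finset.sum_congr rfl fun i _ => ?_
  have : inner ℂ (stdOrthonormalBasis ℂ H i) ((star B * B) (stdOrthonormalBasis ℂ H i))
      = inner ℂ (B (stdOrthonormalBasis ℂ H i)) (B (stdOrthonormalBasis ℂ H i)) := by
    rw [mul_apply_eq_comp, ContinuousLinearMap.star_eq_adjoint,
      ContinuousLinearMap.adjoint_inner_right]
  refine (congrArg Complex.re this).trans ?_
  exact inner_self_eq_norm_sq (𝕜 := ℂ) _

theorem reTrace_star_mul_self_nonneg (B : H →L[ℂ] H) : 0 ≤ reTrace H (star B * B) := by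
  rw [reTrace_star_mul_self]
  positivity

theorem reTrace_star_mul_self_eq_zero {B : H →L[ℂ] H} (h : reTrace H (star B * B) = 0) :
    B = 0 := by
  rw [reTrace_star_mul_self, Finset.sum_eq_zero_iff_of_nonneg (fun _ _ => by positivity)] at h
  have : (B : H →ₗ[ℂ] H) = 0 := by
    refine (stdOrthonormalBasis ℂ H).toBasis.ext fun i => ?_
    simpa using h i (Finset.mem_univ i)
  ext x
  exact LinearMap.congr_fun this x

theorem reTrace_rankOne_self (v : H) :
    reTrace H (InnerProductSpace.rankOne ℂ v v) = ‖v‖ ^ 2 := by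
  rw [reTrace_apply, InnerProductSpace.trace_rankOne]
  exact inner_self_eq_norm_sq (𝕜 := ℂ) _

end Trace

/-! ### Weighted harmonic means and their exact expansion -/

section HarmonicMean

/-- The convex combination `λ A + (1 - λ) X`. -/
def pencil (A X : H →L[ℂ] H) (l : unitInterval) : H →L[ℂ] H :=
  (l : ℝ) • A + (1 - (l : ℝ)) • X

/-- The weighted harmonic mean `((1 - λ) A⁻¹ + λ X⁻¹)⁻¹` in the form `X (λ A + (1 - λ) X)⁻¹ A`. -/
def harmonicMean (A X : H →L[ℂ] H) (l : unitInterval) : H →L[ℂ] H :=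
  X * Ring.inverse (pencil A X l) * A

theorem smul_one_le_pencil {ε : ℝ} {A X : H →L[ℂ] H} (hA : ε • (1 : H →L[ℂ] H) ≤ A)
    (hX : ε • (1 : H →L[ℂ] H) ≤ X) (l : unitInterval) :
    ε • (1 : H →L[ℂ] H) ≤ pencil A X l := by
  calc ε • (1 : H →L[ℂ] H)
      = (l : ℝ) • ε • (1 : H →L[ℂ] H) + (1 - (l : ℝ)) • ε • (1 : H →L[ℂ] H) := by module
    _ ≤ pencil A X l := add_le_add (smul_le_smul_of_nonneg_left hA l.2.1)
        (smul_le_smul_of_nonneg_left hX (by linarith [l.2.2]))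

theorem exists_common_smul_one_le {A X : H →L[ℂ] H} (hA : IsStrictlyPositive A)
    (hX : IsStrictlyPositive X) :
    ∃ ε : ℝ, 0 < ε ∧ ε • (1 : H →L[ℂ] H) ≤ A ∧ ε • (1 : H →L[ℂ] H) ≤ X := by
  obtain ⟨a, ha, hA⟩ := exists_smul_one_le hA
  obtain ⟨b, hb, hX⟩ := exists_smul_one_le hX
  exact ⟨min a b, lt_min ha hb, (smul_one_le_smul_one (min_le_left _ _)).trans hA,
    (smul_one_le_smul_one (min_le_right _ _)).trans hX⟩

theorem isStrictlyPositive_pencil {A X : H →L[ℂ] H} (hA : IsStrictlyPositive A)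
    (hX : IsStrictlyPositive X) (l : unitInterval) : IsStrictlyPositive (pencil A X l) := by
  obtain ⟨ε, hε, hA, hX⟩ := exists_common_smul_one_le hA hX
  exact isStrictlyPositive_of_smul_one_le hε (smul_one_le_pencil hA hX l)

theorem continuous_inverse_pencil {A X : H →L[ℂ] H} (hA : IsStrictlyPositive A)
    (hX : IsStrictlyPositive X) :
    Continuous fun l : unitInterval => Ring.inverse (pencil A X l) := by
  have hc : Continuous (pencil A X) := by unfold pencil; fun_prop
  refine continuous_iff_continuousAt.2 fun l => ?_
  have := NormedRing.inverse_continuousAt (isStrictlyPositive_pencil hA hX l).isUnit.unit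
  exact ContinuousAt.comp (g := Ring.inverse) (f := pencil A X) this hc.continuousAt

theorem continuous_harmonicMean {A X : H →L[ℂ] H} (hA : IsStrictlyPositive A)
    (hX : IsStrictlyPositive X) : Continuous (harmonicMean A X) :=
  (continuous_const.mul (continuous_inverse_pencil hA hX)).mul continuous_const

theorem pencil_sub (A X Y : H →L[ℂ] H) (l : unitInterval) :
    pencil A Y l - pencil A X l = (1 - (l : ℝ)) • (Y - X) := by
  unfold pencil; module

/-- This is the resolvent identity. Inserting it once into the first-order increment yields a
second-order formula that is exact, with the inverse at `Y` kept in the remainder. -/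
theorem inverse_pencil_eq {A X Y : H →L[ℂ] H} (hA : IsStrictlyPositive A)
    (hX : IsStrictlyPositive X) (hY : IsStrictlyPositive Y) (l : unitInterval) :
    Ring.inverse (pencil A Y l) = Ring.inverse (pencil A X l) -
      (1 - (l : ℝ)) • (Ring.inverse (pencil A Y l) * (Y - X) * Ring.inverse (pencil A X l)) := by
  have hx := Ring.mul_inverse_cancel _ (isStrictlyPositive_pencil hA hX l).isUnit
  have hy := Ring.inverse_mul_cancel _ (isStrictlyPositive_pencil hA hY l).isUnit
  have h := pencil_sub A X Y l
  rw [← smul_mul_assoc, ← mul_smul_comm, ← h, mul_sub, hy, sub_mul, one_mul, mul_assoc, hx, mul_one]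
  abel

/-- The exact increment of the weighted harmonic mean in its second argument. -/
theorem harmonicMean_sub {A X Y : H →L[ℂ] H} (hA : IsStrictlyPositive A)
    (hX : IsStrictlyPositive X) (hY : IsStrictlyPositive Y) (l : unitInterval) :
    harmonicMean A Y l - harmonicMean A X l =
      (l : ℝ) • (A * Ring.inverse (pencil A X l) * (Y - X) * Ring.inverse (pencil A Y l) * A) := by
  have hx := Ring.mul_inverse_cancel _ (isStrictlyPositive_pencil hA hX l).isUnit
  have hx' := Ring.inverse_mul_cancel _ (isStrictlyPositive_pencil hA hX l).isUnit
  have hy := Ring.mul_inverse_cancel _ (isStrictlyPositive_pencil hA hY l).isUnit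
  have h := pencil_sub A X Y l
  -- With `T`, `T'` the pencils at `X`, `Y`, this turns `λ A T⁻¹` into `1 - (1 - λ) X T⁻¹`; since
  -- `(1 - λ)(Y - X) = T' - T`, the product `λ A T⁻¹ (Y - X)` collapses to `Y - X T⁻¹ T'`.
  have hlA : (l : ℝ) • A = pencil A X l - (1 - (l : ℝ)) • X := by unfold pencil; abel
  unfold harmonicMean
  set T := pencil A X l
  set T' := pencil A Y l
  rw [← smul_mul_assoc, ← smul_mul_assoc, ← smul_mul_assoc, ← smul_mul_assoc, hlA,
    sub_mul (T) _ (Ring.inverse T), hx, sub_mul 1, one_mul, smul_mul_assoc, smul_mul_assoc,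
    ← mul_smul_comm, ← h, mul_sub, mul_assoc X _ T, hx', mul_one, ← sub_mul]
  congr 1
  have : X * Ring.inverse T = X * Ring.inverse T * T' * Ring.inverse T' := by
    rw [mul_assoc _ T', hy, mul_one]
  nth_rewrite 1 [this]
  rw [← sub_mul]
  congr 1
  abel

/-- The exact second-order expansion of the weighted harmonic mean in its second argument. -/
theorem harmonicMean_expansion {A X Y : H →L[ℂ] H} (hA : IsStrictlyPositive A)
    (hX : IsStrictlyPositive X) (hY : IsStrictlyPositive Y) (l : unitInterval) :
    harmonicMean A Y l - harmonicMean A X l =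
      (l : ℝ) • (A * Ring.inverse (pencil A X l) * (Y - X) * Ring.inverse (pencil A X l) * A) -
      ((l : ℝ) * (1 - l)) • (A * Ring.inverse (pencil A X l) * (Y - X) *
        Ring.inverse (pencil A Y l) * (Y - X) * Ring.inverse (pencil A X l) * A) := by
  rw [harmonicMean_sub hA hX hY]
  nth_rewrite 1 [inverse_pencil_eq hA hX hY]
  rw [mul_sub, sub_mul, smul_sub, mul_smul_comm, smul_mul_assoc, smul_smul]
  simp only [mul_assoc]

theorem kernel_denom_pos (l : unitInterval) {x : ℝ} (hx : 0 < x) :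
    0 < (1 - (l : ℝ)) * x + l := by
  have h1 := l.2.2
  rcases l.2.1.eq_or_lt with h | h
  · rw [← h]; simpa using hx
  · nlinarith [mul_nonneg (sub_nonneg.2 h1) hx.le]

/-- The calculus is multiplicative and sends the denominator to `pencil 1 C l`; multiplying by it
returns `C`, and the pencil is invertible. -/
theorem cfc_kernel {C : H →L[ℂ] H} (hC : IsStrictlyPositive C) (l : unitInterval) :
    cfc (fun x : ℝ => x / ((1 - (l : ℝ)) * x + l)) C = C * Ring.inverse (pencil 1 C l) := by
  have hpos : ∀ x ∈ spectrum ℝ C, 0 < (1 - (l : ℝ)) * x + l := fun x hx =>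
    kernel_denom_pos l (hC.spectrum_pos hx)
  have hCs := hC.isSelfAdjoint
  have hD : cfc (fun x : ℝ => (1 - (l : ℝ)) * x + l) C = pencil 1 C l := by
    rw [cfc_add_const _ _ C, cfc_const_mul _ _ C, cfc_id' ℝ C, Algebra.algebraMap_eq_smul_one,
      pencil, add_comm]
  have hcont : ContinuousOn (fun x : ℝ => x / ((1 - (l : ℝ)) * x + l)) (spectrum ℝ C) :=
    ContinuousOn.div (by fun_prop) (by fun_prop) fun x hx => (hpos x hx).ne'
  have hmul : cfc (fun x : ℝ => x / ((1 - (l : ℝ)) * x + l)) C * pencil 1 C l = C := by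
    rw [← hD, ← cfc_mul _ _ C hcont (by fun_prop)]
    conv_rhs => rw [← cfc_id' ℝ C]
    exact cfc_congr fun x hx => div_mul_cancel₀ _ (hpos x hx).ne'
  have hu := (isStrictlyPositive_pencil isStrictlyPositive_one hC l).isUnit
  calc _ = cfc (fun x : ℝ => x / ((1 - (l : ℝ)) * x + l)) C * pencil 1 C l *
        Ring.inverse (pencil 1 C l) := by rw [mul_assoc, Ring.mul_inverse_cancel _ hu, mul_one]
    _ = _ := by rw [hmul]

theorem isStrictlyPositive_conj_inverse_sqrt {A B : H →L[ℂ] H} (hA : IsStrictlyPositive A)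
    (hB : IsStrictlyPositive B) :
    IsStrictlyPositive (Ring.inverse (CFC.sqrt A) * B * Ring.inverse (CFC.sqrt A)) :=
  IsStrictlyPositive.conjugate_of_isUnit_of_isSelfAdjoint _ _
    (hA.sqrt.ringInverse).isUnit (hA.sqrt.ringInverse).isSelfAdjoint hB

/-- The pencil is compatible with congruence: `pencil A B l` is the pencil of `1` and `A^{-1/2} B
A^{-1/2}` conjugated by `A^{1/2}`, so the square roots cancel. -/
theorem sqrt_mul_cfc_kernel_mul_sqrt {A B : H →L[ℂ] H} (hA : IsStrictlyPositive A)
    (hB : IsStrictlyPositive B) (l : unitInterval) :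
    CFC.sqrt A * cfc (fun x : ℝ => x / ((1 - (l : ℝ)) * x + l))
      (Ring.inverse (CFC.sqrt A) * B * Ring.inverse (CFC.sqrt A)) * CFC.sqrt A
      = harmonicMean A B l := by
  have hC := isStrictlyPositive_conj_inverse_sqrt hA hB
  rw [cfc_kernel hC]
  have hR := hA.sqrt.isUnit
  have hRR : CFC.sqrt A * CFC.sqrt A = A := CFC.sqrt_mul_sqrt_self A hA.nonneg
  unfold harmonicMean
  set R := CFC.sqrt A
  have h1 := Ring.mul_inverse_cancel _ hR
  have h2 := Ring.inverse_mul_cancel _ hR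
  set S := Ring.inverse R
  have hT : pencil A B l = R * pencil 1 (S * B * S) l * R := by
    simp only [pencil, mul_add, add_mul, mul_smul_comm, smul_mul_assoc, mul_one, hRR]
    congr 2
    rw [← mul_assoc, ← mul_assoc, h1, one_mul, mul_assoc, h2, mul_one]
  have hD := (isStrictlyPositive_pencil isStrictlyPositive_one hC l).isUnit
  set D := pencil 1 (S * B * S) l
  have h3 := Ring.mul_inverse_cancel _ hD
  have h4 := Ring.inverse_mul_cancel _ hD
  have hTi : Ring.inverse (pencil A B l) = S * Ring.inverse D * S := by
    rw [hT]
    apply inverse_eq_of_mul_eq_one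
    · calc R * D * R * (S * Ring.inverse D * S) = R * D * (R * S) * Ring.inverse D * S := by
            simp only [mul_assoc]
        _ = R * (D * Ring.inverse D) * S := by rw [h1]; simp only [mul_assoc, one_mul]
        _ = 1 := by rw [h3, mul_one, h1]
    · calc S * Ring.inverse D * S * (R * D * R) = S * Ring.inverse D * (S * R) * D * R := by
            simp only [mul_assoc]
        _ = S * (Ring.inverse D * D) * R := by rw [h2]; simp only [mul_assoc, one_mul]
        _ = 1 := by rw [h4, mul_one, h2]
  rw [hTi, ← hRR]
  calc R * (S * B * S * Ring.inverse D) * R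
      = (R * S) * B * S * Ring.inverse D * R := by simp only [mul_assoc]
    _ = B * S * Ring.inverse D * (S * R) * R := by rw [h1, h2]; simp only [mul_assoc, one_mul]
    _ = _ := by simp only [mul_assoc]

end HarmonicMean

/-! ### Integral representation of the operator mean -/

section Integral

variable (μ : Measure unitInterval) [IsProbabilityMeasure μ]

theorem integrable_of_continuous {E : Type*} [NormedAddCommGroup E] {f : unitInterval → E}
    (hf : Continuous f) : Integrable f μ := by
  simpa using hf.continuousOn.integrableOn_compact (μ := μ) isCompact_univ

theorem kuboAndo_genFun {A B : H →L[ℂ] H} (hA : IsStrictlyPositive A)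
    (hB : IsStrictlyPositive B) :
    kuboAndo (genFun μ) A B = ∫ l, harmonicMean A B l ∂μ := by
  have hC := isStrictlyPositive_conj_inverse_sqrt hA hB
  have key : cfc (genFun μ) (Ring.inverse (CFC.sqrt A) * B * Ring.inverse (CFC.sqrt A)) =
      ∫ l : unitInterval, cfc (fun x : ℝ => x / ((1 - (l : ℝ)) * x + l))
        (Ring.inverse (CFC.sqrt A) * B * Ring.inverse (CFC.sqrt A)) ∂μ := by
    set C := Ring.inverse (CFC.sqrt A) * B * Ring.inverse (CFC.sqrt A)
    -- The spectrum of `C` is compact and positive, so the kernel is jointly continuous, hence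
    -- bounded, and the calculus commutes with the integral.
    have hcont : ContinuousOn (Function.uncurry
        fun (l : unitInterval) (x : ℝ) => x / ((1 - (l : ℝ)) * x + l))
        (Set.univ ×ˢ spectrum ℝ C) := by
      refine ContinuousOn.div (by fun_prop) (by fun_prop) ?_
      rintro ⟨l, x⟩ ⟨-, hx⟩
      exact (kernel_denom_pos l (hC.spectrum_pos hx)).ne'
    obtain ⟨K, hK⟩ := (isCompact_univ.prod
      (ContinuousFunctionalCalculus.isCompact_spectrum (R := ℝ) C)).exists_bound_of_continuousOn
      hcont
    exact cfc_integral _ (fun _ => K) C hcont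
      (.of_forall fun l z hz => hK (l, z) ⟨Set.mem_univ _, hz⟩)
      (integrable_const K).2 hC.isSelfAdjoint
  have hint : Integrable (fun l : unitInterval => cfc (fun x : ℝ => x / ((1 - (l : ℝ)) * x + l))
        (Ring.inverse (CFC.sqrt A) * B * Ring.inverse (CFC.sqrt A))) μ := by
    simp only [cfc_kernel hC]
    exact integrable_of_continuous μ (continuous_const.mul
      (continuous_inverse_pencil isStrictlyPositive_one hC))
  rw [kuboAndo, key, ← integral_const_mul_of_integrable hint,
    ← integral_mul_const_of_integrable (hint.const_mul _)]
  simp only [sqrt_mul_cfc_kernel_mul_sqrt hA hB]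

end Integral

/-! ### Gradient and second-order remainder of the divergence -/

section Gradient

variable (μ : Measure unitInterval) [IsProbabilityMeasure μ]

/-- The operator `(λ A + (1 - λ) X)⁻¹ A² (λ A + (1 - λ) X)⁻¹`. -/
def gradientKernel (A X : H →L[ℂ] H) (l : unitInterval) : H →L[ℂ] H :=
  Ring.inverse (pencil A X l) * A * A * Ring.inverse (pencil A X l)

/-- The gradient of `X ↦ φ_μ(A, X)` with respect to the trace inner product. -/
def gradient (μ : Measure unitInterval) (A X : H →L[ℂ] H) : H →L[ℂ] H :=
  centerOfMass μ • 1 - ∫ l : unitInterval, (l : ℝ) • gradientKernel A X l ∂μ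

theorem continuous_gradientKernel {A X : H →L[ℂ] H} (hA : IsStrictlyPositive A)
    (hX : IsStrictlyPositive X) : Continuous (gradientKernel A X) := by
  have := continuous_inverse_pencil hA hX
  unfold gradientKernel
  fun_prop

theorem integrable_smul_gradientKernel {A X : H →L[ℂ] H} (hA : IsStrictlyPositive A)
    (hX : IsStrictlyPositive X) :
    Integrable (fun l : unitInterval => (l : ℝ) • gradientKernel A X l) μ :=
  integrable_of_continuous μ (continuous_subtype_val.smul (continuous_gradientKernel hA hX))

theorem isSelfAdjoint_gradientKernel {A X : H →L[ℂ] H} (hA : IsStrictlyPositive A)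
    (hX : IsStrictlyPositive X) (l : unitInterval) : IsSelfAdjoint (gradientKernel A X l) := by
  have h1 := (isStrictlyPositive_pencil hA hX l).ringInverse.isSelfAdjoint
  rw [isSelfAdjoint_iff, gradientKernel]
  simp only [star_mul, h1.star_eq, hA.isSelfAdjoint.star_eq, mul_assoc]

theorem isSelfAdjoint_gradient {A X : H →L[ℂ] H} (hA : IsStrictlyPositive A)
    (hX : IsStrictlyPositive X) : IsSelfAdjoint (gradient μ A X) := by
  have h : star (∫ l : unitInterval, (l : ℝ) • gradientKernel A X l ∂μ) =
      ∫ l : unitInterval, (l : ℝ) • gradientKernel A X l ∂μ := by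
    have := (starL' ℝ (A := H →L[ℂ] H)).toContinuousLinearMap.integral_comp_comm
      (integrable_smul_gradientKernel μ hA hX)
    refine this.symm.trans (integral_congr_ae (.of_forall fun l => ?_))
    simp [(isSelfAdjoint_gradientKernel hA hX l).star_eq]
  rw [isSelfAdjoint_iff, gradient, star_sub, h, star_smul, star_one]
  simp

variable [FiniteDimensional ℂ H]

/-- The trace density of the second-order remainder in the expansion of `φ_μ(A, ·)` at `X`. -/
def remainderKernel (A X Y : H →L[ℂ] H) (l : unitInterval) : ℝ :=
  reTrace H (A * Ring.inverse (pencil A X l) * (Y - X) *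
        Ring.inverse (pencil A Y l) * (Y - X) * Ring.inverse (pencil A X l) * A)

theorem continuous_remainderKernel {A X Y : H →L[ℂ] H} (hA : IsStrictlyPositive A)
    (hX : IsStrictlyPositive X) (hY : IsStrictlyPositive Y) :
    Continuous (remainderKernel A X Y) := by
  have := continuous_inverse_pencil hA hX
  have := continuous_inverse_pencil hA hY
  unfold remainderKernel
  fun_prop

theorem continuous_mul_remainderKernel {A X Y : H →L[ℂ] H} (hA : IsStrictlyPositive A)
    (hX : IsStrictlyPositive X) (hY : IsStrictlyPositive Y) :
    Continuous fun l : unitInterval => (l : ℝ) * (1 - l) * remainderKernel A X Y l := by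
  have := continuous_remainderKernel hA hX hY
  fun_prop

theorem divergence_eq {A X : H →L[ℂ] H} (hA : IsStrictlyPositive A) (hX : IsStrictlyPositive X) :
    divergence μ A X = (1 - centerOfMass μ) * reTrace H A + centerOfMass μ * reTrace H X -
      ∫ l, reTrace H (harmonicMean A X l) ∂μ := by
  rw [divergence, ← reTrace_apply, kuboAndo_genFun μ hA hX, map_sub, map_add, map_smul, map_smul,
    ContinuousLinearMap.integral_comp_comm _
      (integrable_of_continuous μ (continuous_harmonicMean hA hX))]
  simp

theorem divergence_sub_eq {A X Y : H →L[ℂ] H} (hA : IsStrictlyPositive A)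
    (hX : IsStrictlyPositive X) (hY : IsStrictlyPositive Y) :
    divergence μ A Y - divergence μ A X = centerOfMass μ * reTrace H (Y - X) -
      ∫ l, reTrace H (harmonicMean A Y l - harmonicMean A X l) ∂μ := by
  have hi : ∀ {Z : H →L[ℂ] H}, IsStrictlyPositive Z →
      Integrable (fun l => reTrace H (harmonicMean A Z l)) μ := fun hZ =>
    integrable_of_continuous μ ((reTrace H).continuous.comp (continuous_harmonicMean hA hZ))
  simp only [map_sub]
  rw [divergence_eq μ hA hX, divergence_eq μ hA hY, integral_sub (hi hY) (hi hX)]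
  ring

theorem divergence_expansion {A X Y : H →L[ℂ] H} (hA : IsStrictlyPositive A)
    (hX : IsStrictlyPositive X) (hY : IsStrictlyPositive Y) :
    divergence μ A Y - divergence μ A X = reTrace H (gradient μ A X * (Y - X)) +
      ∫ l : unitInterval, (l : ℝ) * (1 - l) * remainderKernel A X Y l ∂μ := by
  have hk := integrable_smul_gradientKernel μ hA hX
  have hi1 : Integrable (fun l : unitInterval =>
      reTrace H ((l : ℝ) • gradientKernel A X l * (Y - X))) μ :=
    (reTrace H).integrable_comp (hk.mul_const _)
  have hg : reTrace H (gradient μ A X * (Y - X)) = centerOfMass μ * reTrace H (Y - X) -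
      ∫ l : unitInterval, reTrace H ((l : ℝ) • gradientKernel A X l * (Y - X)) ∂μ := by
    rw [gradient, sub_mul, map_sub, ← integral_mul_const_of_integrable hk,
      ← ContinuousLinearMap.integral_comp_comm _ (hk.mul_const _)]
    simp
  rw [hg, divergence_sub_eq μ hA hX hY, sub_add, ← integral_sub hi1
    (integrable_of_continuous μ (continuous_mul_remainderKernel hA hX hY))]
  congr 2
  ext l
  rw [harmonicMean_expansion hA hX hY, map_sub, map_smul, map_smul, smul_mul_assoc, map_smul,
    remainderKernel, smul_eq_mul, smul_eq_mul, smul_eq_mul]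
  congr 2
  -- Cyclicity of the trace moves `T⁻¹ A` to the front, producing the gradient kernel times `Y - X`.
  have := reTrace_mul_comm (A * Ring.inverse (pencil A X l) * (Y - X))
    (Ring.inverse (pencil A X l) * A)
  simpa only [gradientKernel, mul_assoc] using this

/-- Splitting the middle inverse into two square roots exhibits a product of an operator with its
adjoint. All factors of `B` except `Y - X` are invertible, which gives strictness. -/
theorem remainderKernel_eq {A X Y : H →L[ℂ] H} (hA : IsStrictlyPositive A)
    (hX : IsStrictlyPositive X) (hY : IsStrictlyPositive Y) (l : unitInterval) :
    ∃ B : H →L[ℂ] H, remainderKernel A X Y l = reTrace H (star B * B) ∧ (B = 0 → X = Y) := by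
  have hT := isStrictlyPositive_pencil hA hX l
  have hT' := (isStrictlyPositive_pencil hA hY l).ringInverse
  have hd : IsSelfAdjoint (Y - X) := hY.isSelfAdjoint.sub hX.isSelfAdjoint
  refine ⟨CFC.sqrt (Ring.inverse (pencil A Y l)) * (Y - X) * Ring.inverse (pencil A X l) * A,
    ?_, fun h => ?_⟩
  · rw [remainderKernel]
    congr 1
    nth_rewrite 1 [← CFC.sqrt_mul_sqrt_self _ hT'.nonneg]
    simp only [star_mul, hd.star_eq, hA.isSelfAdjoint.star_eq, hT.ringInverse.isSelfAdjoint.star_eq,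
      hT'.sqrt.isSelfAdjoint.star_eq, mul_assoc]
  · rw [hA.isUnit.mul_left_eq_zero, hT.ringInverse.isUnit.mul_left_eq_zero,
      hT'.sqrt.isUnit.mul_right_eq_zero] at h
    exact (sub_eq_zero.1 h).symm

theorem remainderKernel_nonneg {A X Y : H →L[ℂ] H} (hA : IsStrictlyPositive A)
    (hX : IsStrictlyPositive X) (hY : IsStrictlyPositive Y) (l : unitInterval) :
    0 ≤ remainderKernel A X Y l := by
  obtain ⟨B, hB, -⟩ := remainderKernel_eq hA hX hY l
  rw [hB]
  exact reTrace_star_mul_self_nonneg B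

theorem remainderKernel_pos {A X Y : H →L[ℂ] H} (hA : IsStrictlyPositive A)
    (hX : IsStrictlyPositive X) (hY : IsStrictlyPositive Y) (h : X ≠ Y) (l : unitInterval) :
    0 < remainderKernel A X Y l := by
  obtain ⟨B, hB, hB0⟩ := remainderKernel_eq hA hX hY l
  refine (remainderKernel_nonneg hA hX hY l).lt_of_ne fun h0 => h (hB0 ?_)
  exact reTrace_star_mul_self_eq_zero (hB ▸ h0.symm)

/-- A nonnegative continuous function which is positive on `(0,1)` has positive integral. -/
theorem integral_pos_of_pos_on_Ioo (hμ : μ (Set.Ioo 0 1) ≠ 0) {f : unitInterval → ℝ}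
    (hf : Continuous f) (h0 : ∀ l, 0 ≤ f l) (h1 : ∀ l ∈ Set.Ioo (0 : unitInterval) 1, 0 < f l) :
    0 < ∫ l, f l ∂μ := by
  rw [integral_pos_iff_support_of_nonneg h0 (integrable_of_continuous μ hf)]
  refine (pos_iff_ne_zero.2 hμ).trans_le (measure_mono fun l hl => (h1 l hl).ne')

theorem centerOfMass_pos (hμ : μ (Set.Ioo 0 1) ≠ 0) : 0 < centerOfMass μ :=
  integral_pos_of_pos_on_Ioo μ hμ continuous_subtype_val (fun l => l.2.1) fun _ hl => hl.1

theorem integral_remainderKernel_pos (hμ : μ (Set.Ioo 0 1) ≠ 0) {A X Y : H →L[ℂ] H}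
    (hA : IsStrictlyPositive A) (hX : IsStrictlyPositive X) (hY : IsStrictlyPositive Y)
    (h : X ≠ Y) : 0 < ∫ l : unitInterval, (l : ℝ) * (1 - l) * remainderKernel A X Y l ∂μ := by
  refine integral_pos_of_pos_on_Ioo μ hμ (continuous_mul_remainderKernel hA hX hY)
    (fun l => mul_nonneg (mul_nonneg l.2.1 (sub_nonneg.2 l.2.2))
      (remainderKernel_nonneg hA hX hY l)) fun l hl => mul_pos (mul_pos hl.1 (sub_pos.2 hl.2))
      (remainderKernel_pos hA hX hY h l)

/-- The bound is quadratic in `Y - X`, so along a segment the linear term dominates for small steps.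
-/
theorem integral_remainderKernel_le {ε : ℝ} (hε : 0 < ε) {A X Y : H →L[ℂ] H}
    (hA : ε • (1 : H →L[ℂ] H) ≤ A) (hX : ε • (1 : H →L[ℂ] H) ≤ X)
    (hY : ε • (1 : H →L[ℂ] H) ≤ Y) :
    ∫ l : unitInterval, (l : ℝ) * (1 - l) * remainderKernel A X Y l ∂μ ≤
      ‖reTrace H‖ * (‖A‖ * ε⁻¹ * ‖Y - X‖ * ε⁻¹ * ‖Y - X‖ * ε⁻¹ * ‖A‖) := by
  refine (Real.le_norm_self _).trans ?_
  have := norm_integral_le_of_norm_le_const (μ := μ)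
    (f := fun l : unitInterval => (l : ℝ) * (1 - l) * remainderKernel A X Y l)
    (C := ‖reTrace H‖ * (‖A‖ * ε⁻¹ * ‖Y - X‖ * ε⁻¹ * ‖Y - X‖ * ε⁻¹ * ‖A‖)) (.of_forall fun l => ?_)
  · simpa using this
  rw [norm_mul]
  have h1 : ‖(l : ℝ) * (1 - l)‖ ≤ 1 := by
    have h0 := l.2.1
    have h1 := l.2.2
    rw [Real.norm_of_nonneg (mul_nonneg h0 (sub_nonneg.2 h1))]
    nlinarith
  refine (mul_le_of_le_one_left (norm_nonneg _) h1).trans ?_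
  refine ((reTrace H).le_opNorm _).trans ?_
  have h2 := norm_inverse_le hε (smul_one_le_pencil hA hX l)
  have h3 := norm_inverse_le hε (smul_one_le_pencil hA hY l)
  gcongr
  refine norm_mul_le_of_le (norm_mul_le_of_le (norm_mul_le_of_le (norm_mul_le_of_le
    (norm_mul_le_of_le (norm_mul_le_of_le le_rfl ?_) le_rfl) ?_) le_rfl) ?_) le_rfl <;> assumption

/-- A Lipschitz bound on operators above `ε`; it supplies the continuity needed for compactness. -/
theorem abs_divergence_sub_le {ε : ℝ} (hε : 0 < ε) {A X Y : H →L[ℂ] H}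
    (hA : ε • (1 : H →L[ℂ] H) ≤ A) (hX : ε • (1 : H →L[ℂ] H) ≤ X)
    (hY : ε • (1 : H →L[ℂ] H) ≤ Y) :
    |divergence μ A Y - divergence μ A X| ≤
      ‖reTrace H‖ * (|centerOfMass μ| + ‖A‖ * ε⁻¹ * ε⁻¹ * ‖A‖) * ‖Y - X‖ := by
  have hA' := isStrictlyPositive_of_smul_one_le hε hA
  have hX' := isStrictlyPositive_of_smul_one_le hε hX
  have hY' := isStrictlyPositive_of_smul_one_le hε hY
  rw [divergence_sub_eq μ hA' hX' hY']
  have h1 : |centerOfMass μ * reTrace H (Y - X)| ≤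
      |centerOfMass μ| * (‖reTrace H‖ * ‖Y - X‖) := by
    rw [abs_mul]
    gcongr
    exact (reTrace H).le_opNorm _
  have h2 := norm_integral_le_of_norm_le_const (μ := μ)
    (f := fun l => reTrace H (harmonicMean A Y l - harmonicMean A X l))
    (C := ‖reTrace H‖ * (‖A‖ * ε⁻¹ * ‖Y - X‖ * ε⁻¹ * ‖A‖)) (.of_forall fun l => by
      rw [harmonicMean_sub hA' hX' hY']
      refine ((reTrace H).le_opNorm _).trans ?_
      have h2 := norm_inverse_le hε (smul_one_le_pencil hA hX l)
      have h3 := norm_inverse_le hε (smul_one_le_pencil hA hY l)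
      gcongr
      rw [norm_smul, Real.norm_of_nonneg l.2.1]
      refine (mul_le_of_le_one_left (norm_nonneg _) l.2.2).trans ?_
      refine norm_mul_le_of_le (norm_mul_le_of_le (norm_mul_le_of_le (norm_mul_le_of_le
        le_rfl ?_) le_rfl) ?_) le_rfl <;> assumption)
  refine (abs_sub _ _).trans ((add_le_add h1 h2).trans (le_of_eq ?_))
  simp
  ring

end Gradient

/-! ### The fixed-point equation as the critical equation -/

section Barycenter

variable (μ : Measure unitInterval) [IsProbabilityMeasure μ] {m : ℕ} (A : Fin m → H →L[ℂ] H)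
  (w : Fin m → ℝ)

/-- The gradient of `X ↦ ∑ j, w j * φ_μ(A j, X)` with respect to the trace inner product. -/
def totalGradient (μ : Measure unitInterval) (X : H →L[ℂ] H) : H →L[ℂ] H :=
  ∑ j, w j • gradient μ (A j) X

theorem isSelfAdjoint_totalGradient (hA : ∀ j, IsStrictlyPositive (A j)) {X : H →L[ℂ] H}
    (hX : IsStrictlyPositive X) : IsSelfAdjoint (totalGradient A w μ X) :=
  isSelfAdjoint_sum _ fun j _ => (IsSelfAdjoint.all (w j)).smul (isSelfAdjoint_gradient μ (hA j) hX)

/-- The operator inside the absolute value factors as `Z = A⁻¹ T X^{-1/2}`, with inverse `W =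
X^{1/2} T⁻¹ A`; hence `(Z* Z)⁻¹ = W W*`. -/
theorem inverse_abs_sq_eq {A X : H →L[ℂ] H} (hA : IsStrictlyPositive A)
    (hX : IsStrictlyPositive X) (l : unitInterval) :
    Ring.inverse (CFC.abs ((1 - (l : ℝ)) • (Ring.inverse A * CFC.sqrt X)
        + (l : ℝ) • Ring.inverse (CFC.sqrt X)) ^ 2) =
      CFC.sqrt X * gradientKernel A X l * CFC.sqrt X := by
  rw [CFC.abs_sq, gradientKernel]
  have hRR : CFC.sqrt X * CFC.sqrt X = X := CFC.sqrt_mul_sqrt_self X hX.nonneg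
  have hRs := hX.sqrt.isSelfAdjoint.star_eq
  have hR := Ring.mul_inverse_cancel _ hX.sqrt.isUnit
  have hR' := Ring.inverse_mul_cancel _ hX.sqrt.isUnit
  have hAi := Ring.mul_inverse_cancel _ hA.isUnit
  have hAi' := Ring.inverse_mul_cancel _ hA.isUnit
  have hTp := isStrictlyPositive_pencil hA hX l
  have hTs := hTp.ringInverse.isSelfAdjoint.star_eq
  have hT := Ring.mul_inverse_cancel _ hTp.isUnit
  have hT' := Ring.inverse_mul_cancel _ hTp.isUnit
  have hZ : (1 - (l : ℝ)) • (Ring.inverse A * CFC.sqrt X) + (l : ℝ) • Ring.inverse (CFC.sqrt X)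
      = Ring.inverse A * pencil A X l * Ring.inverse (CFC.sqrt X) := by
    rw [pencil, mul_add, add_mul, mul_smul_comm, mul_smul_comm, hAi', smul_mul_assoc, one_mul,
      smul_mul_assoc, mul_assoc (Ring.inverse A) X]
    have hXS : X * Ring.inverse (CFC.sqrt X) = CFC.sqrt X := by
      calc X * Ring.inverse (CFC.sqrt X)
          = CFC.sqrt X * CFC.sqrt X * Ring.inverse (CFC.sqrt X) := by rw [hRR]
        _ = CFC.sqrt X := by rw [mul_assoc, hR, mul_one]
    rw [hXS, add_comm]
  rw [hZ]
  set R := CFC.sqrt X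
  set S := Ring.inverse R
  set T := pencil A X l
  set U := Ring.inverse T
  set V := Ring.inverse A
  have h1 : V * T * S * (R * U * A) = 1 := by
    calc V * T * S * (R * U * A) = V * T * (S * R) * U * A := by simp only [mul_assoc]
      _ = V * (T * U) * A := by rw [hR', mul_one, mul_assoc V]
      _ = 1 := by rw [hT, mul_one, hAi']
  have h2 : R * U * A * (V * T * S) = 1 := by
    calc R * U * A * (V * T * S) = R * U * (A * V) * T * S := by simp only [mul_assoc]
      _ = R * (U * T) * S := by rw [hAi, mul_one, mul_assoc R]
      _ = 1 := by rw [hT', mul_one, hR]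
  have h3 : R * (U * A * A * U) * R = R * U * A * star (R * U * A) := by
    simp only [star_mul, hRs, hTs, hA.isSelfAdjoint.star_eq, mul_assoc]
  rw [h3]
  apply inverse_eq_of_mul_eq_one
  · calc star (V * T * S) * (V * T * S) * (R * U * A * star (R * U * A))
        = star (V * T * S) * (V * T * S * (R * U * A)) * star (R * U * A) := by
          simp only [mul_assoc]
      _ = 1 := by rw [h1, mul_one, ← star_mul, h2, star_one]
  · calc R * U * A * star (R * U * A) * (star (V * T * S) * (V * T * S))
        = R * U * A * (star (R * U * A) * star (V * T * S)) * (V * T * S) := by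
          simp only [mul_assoc]
      _ = 1 := by rw [← star_mul, h1, star_one, mul_one, h2]

theorem fixedPointMap_eq (hμ : μ (Set.Ioo 0 1) ≠ 0) (hA : ∀ j, IsStrictlyPositive (A j))
    (hw1 : ∑ j, w j = 1) {X : H →L[ℂ] H} (hX : IsStrictlyPositive X) :
    fixedPointMap μ A w X =
      X - (1 / centerOfMass μ) • (CFC.sqrt X * totalGradient A w μ X * CFC.sqrt X) := by
  have hc := (centerOfMass_pos μ hμ).ne'
  have hRR : CFC.sqrt X * CFC.sqrt X = X := CFC.sqrt_mul_sqrt_self X hX.nonneg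
  have hj : ∀ j, ∫ l : unitInterval, (l : ℝ) • Ring.inverse
      (CFC.abs ((1 - (l : ℝ)) • (Ring.inverse (A j) * CFC.sqrt X)
        + (l : ℝ) • Ring.inverse (CFC.sqrt X)) ^ 2) ∂μ =
      centerOfMass μ • X - CFC.sqrt X * gradient μ (A j) X * CFC.sqrt X := by
    intro j
    have hk := integrable_smul_gradientKernel μ (hA j) hX
    simp only [inverse_abs_sq_eq (hA j) hX]
    rw [gradient, mul_sub, sub_mul, ← integral_const_mul_of_integrable hk,
      ← integral_mul_const_of_integrable (hk.const_mul _), mul_smul_comm, mul_one,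
      smul_mul_assoc, hRR, sub_sub_cancel]
    simp only [mul_smul_comm, smul_mul_assoc]
  rw [fixedPointMap]
  simp only [hj, smul_sub, Finset.sum_sub_distrib, ← Finset.sum_smul, hw1, one_smul]
  rw [smul_smul, one_div_mul_cancel hc, one_smul, totalGradient, Finset.mul_sum, Finset.sum_mul]
  simp only [mul_smul_comm, smul_mul_assoc]

theorem eq_fixedPointMap_iff (hμ : μ (Set.Ioo 0 1) ≠ 0) (hA : ∀ j, IsStrictlyPositive (A j))
    (hw1 : ∑ j, w j = 1) {X : H →L[ℂ] H} (hX : IsStrictlyPositive X) :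
    X = fixedPointMap μ A w X ↔ totalGradient A w μ X = 0 := by
  have hc := (centerOfMass_pos μ hμ).ne'
  have hu := hX.sqrt.isUnit
  rw [fixedPointMap_eq μ A w hμ hA hw1 hX, eq_comm, sub_eq_self, smul_eq_zero,
    hu.mul_left_eq_zero, hu.mul_right_eq_zero]
  simp [hc]

/-! ### Global optimality and the first-order condition -/

variable [FiniteDimensional ℂ H]

theorem objective_expansion (hA : ∀ j, IsStrictlyPositive (A j)) {X Y : H →L[ℂ] H}
    (hX : IsStrictlyPositive X) (hY : IsStrictlyPositive Y) :
    ∑ j, w j * divergence μ (A j) Y = ∑ j, w j * divergence μ (A j) X +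
      reTrace H (totalGradient A w μ X * (Y - X)) +
      ∑ j, w j * ∫ l : unitInterval, (l : ℝ) * (1 - l) * remainderKernel (A j) X Y l ∂μ := by
  rw [totalGradient, Finset.sum_mul, map_sum, ← Finset.sum_add_distrib, ← Finset.sum_add_distrib]
  refine Finset.sum_congr rfl fun j _ => ?_
  have := divergence_expansion μ (hA j) hX hY
  rw [smul_mul_assoc, map_smul, smul_eq_mul]
  linear_combination w j * this

variable {A w}

theorem nonempty_of_sum_eq_one (hw1 : ∑ j, w j = 1) :
    (Finset.univ : Finset (Fin m)).Nonempty := by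
  by_contra h
  rw [Finset.not_nonempty_iff_eq_empty] at h
  simp [h] at hw1

/-- A zero of the gradient is a strict global minimizer. -/
theorem objective_lt_of_totalGradient_eq_zero (hμ : μ (Set.Ioo 0 1) ≠ 0)
    (hA : ∀ j, IsStrictlyPositive (A j)) (hw : ∀ j, 0 < w j) (hw1 : ∑ j, w j = 1)
    {X Y : H →L[ℂ] H} (hX : IsStrictlyPositive X) (hY : IsStrictlyPositive Y) (h : X ≠ Y)
    (h0 : totalGradient A w μ X = 0) :
    ∑ j, w j * divergence μ (A j) X < ∑ j, w j * divergence μ (A j) Y := by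
  rw [objective_expansion μ A w hA hX hY, h0, zero_mul, map_zero, add_zero]
  refine lt_add_of_pos_right _ (Finset.sum_pos (fun j _ => ?_) (nonempty_of_sum_eq_one hw1))
  exact mul_pos (hw j) (integral_remainderKernel_pos μ hμ (hA j) hX hY h)

/-- The first-order condition at a minimizer along a segment. -/
theorem reTrace_totalGradient_mul_nonneg {ε : ℝ} (hε : 0 < ε)
    (hA : ∀ j, ε • (1 : H →L[ℂ] H) ≤ A j) (hw : ∀ j, 0 < w j) {X D : H →L[ℂ] H} {t₀ : ℝ}
    (ht₀ : 0 < t₀) (hmem : ∀ t, 0 ≤ t → t ≤ t₀ → ε • (1 : H →L[ℂ] H) ≤ X + t • D)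
    (hmin : ∀ t, 0 ≤ t → t ≤ t₀ →
      ∑ j, w j * divergence μ (A j) X ≤ ∑ j, w j * divergence μ (A j) (X + t • D)) :
    0 ≤ reTrace H (totalGradient A w μ X * D) := by
  have hX : ε • (1 : H →L[ℂ] H) ≤ X := by simpa using hmem 0 le_rfl ht₀.le
  have hA' := fun j => isStrictlyPositive_of_smul_one_le hε (hA j)
  have hX' := isStrictlyPositive_of_smul_one_le hε hX
  set g := reTrace H (totalGradient A w μ X * D)
  set M := ∑ j, w j * (‖reTrace H‖ * (‖A j‖ * ε⁻¹ * ‖D‖ * ε⁻¹ * ‖D‖ * ε⁻¹ * ‖A j‖)) with hM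
  have hM0 : 0 ≤ M := Finset.sum_nonneg fun j _ => mul_nonneg (hw j).le (by positivity)
  have key : ∀ t, 0 < t → t ≤ t₀ → 0 ≤ g + t * M := by
    intro t ht htt
    have hYm := hmem t ht.le htt
    have h1 := hmin t ht.le htt
    rw [objective_expansion μ A w hA' hX' (isStrictlyPositive_of_smul_one_le hε hYm)] at h1
    have h2 : ∑ j, w j * ∫ l : unitInterval,
        (l : ℝ) * (1 - l) * remainderKernel (A j) X (X + t • D) l ∂μ ≤ t ^ 2 * M := by
      rw [hM, Finset.mul_sum]
      refine Finset.sum_le_sum fun j _ => ?_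
      refine (mul_le_mul_of_nonneg_left
        (integral_remainderKernel_le μ hε (hA j) hX hYm) (hw j).le).trans (le_of_eq ?_)
      rw [add_sub_cancel_left, norm_smul, Real.norm_of_nonneg ht.le]
      ring
    rw [add_sub_cancel_left, mul_smul_comm, map_smul, smul_eq_mul] at h1
    have h3 : 0 ≤ t * (g + t * M) := by
      have : 0 ≤ t * g + t ^ 2 * M := by linarith
      linarith
    exact nonneg_of_mul_nonneg_right h3 ht
  by_contra! hg
  -- At this step length `t M ≤ -g / 2`, so `g + t M ≤ g / 2 < 0`; the `M + 1` avoids division by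
  -- zero.
  have ht : 0 < min t₀ (-g / (2 * (M + 1))) :=
    lt_min ht₀ (div_pos (neg_pos.2 hg) (by positivity))
  have h1 := key _ ht (min_le_left _ _)
  have h2 : min t₀ (-g / (2 * (M + 1))) * M ≤ -g / (2 * (M + 1)) * (M + 1) :=
    mul_le_mul (min_le_right _ _) (by linarith) hM0 (ht.le.trans (min_le_right _ _))
  have h3 : -g / (2 * (M + 1)) * (M + 1) = -g / 2 := by field_simp
  linarith

/-! ### Sign of the gradient at extreme eigenvectors -/

theorem reTrace_mul_rankOne_self (B : H →L[ℂ] H) (v : H) :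
    reTrace H (B * InnerProductSpace.rankOne ℂ v v) = (inner ℂ v (B v)).re := by
  have : B * InnerProductSpace.rankOne ℂ v v = InnerProductSpace.rankOne ℂ (B v) v := by
    ext x
    simp
  rw [this, reTrace_apply, InnerProductSpace.trace_rankOne]

/-- The derivative in the direction of the projection onto `v` has a sign settled by comparing the
norm of `u = A T⁻¹ v` with 1. -/
theorem reTrace_gradient_mul_rankOne_self {A X : H →L[ℂ] H} (hA : IsStrictlyPositive A)
    (hX : IsStrictlyPositive X) {v : H} (hv : ‖v‖ = 1) :
    reTrace H (gradient μ A X * InnerProductSpace.rankOne ℂ v v) =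
      ∫ l : unitInterval, (l : ℝ) * (1 - ‖A (Ring.inverse (pencil A X l) v)‖ ^ 2) ∂μ := by
  have hk := integrable_smul_gradientKernel μ hA hX
  have hc : Continuous fun l : unitInterval =>
      (l : ℝ) * ‖A (Ring.inverse (pencil A X l) v)‖ ^ 2 := by
    have := continuous_inverse_pencil hA hX
    fun_prop
  simp only [mul_sub, mul_one]
  rw [integral_sub (integrable_of_continuous μ continuous_subtype_val)
    (integrable_of_continuous μ hc), gradient, sub_mul, map_sub,
    ← integral_mul_const_of_integrable hk,
    ← ContinuousLinearMap.integral_comp_comm _ (hk.mul_const _)]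
  congr 1
  · rw [smul_mul_assoc, one_mul, map_smul, reTrace_rankOne_self, hv, centerOfMass]
    simp
  · refine integral_congr_ae (.of_forall fun l => ?_)
    simp only [smul_mul_assoc, map_smul, smul_eq_mul, reTrace_mul_rankOne_self, gradientKernel]
    congr 1
    have h1 := (isStrictlyPositive_pencil hA hX l).ringInverse.isSelfAdjoint
    have h2 := hA.isSelfAdjoint
    have h3 : inner ℂ v ((Ring.inverse (pencil A X l) * A * A * Ring.inverse (pencil A X l)) v)
        = inner ℂ (A (Ring.inverse (pencil A X l) v)) (A (Ring.inverse (pencil A X l) v)) := by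
      simp only [mul_apply_eq_comp]
      rw [← ContinuousLinearMap.adjoint_inner_left, ← ContinuousLinearMap.star_eq_adjoint,
        h1.star_eq, ← ContinuousLinearMap.adjoint_inner_left,
        ← ContinuousLinearMap.star_eq_adjoint, h2.star_eq]
    rw [h3]
    exact inner_self_eq_norm_sq (𝕜 := ℂ) _

/-- On an eigenvector `v` of `X`, the vector `u = A (λ A + (1 - λ) X)⁻¹ v` solves
`(λ X⁻¹ + (1 - λ) A⁻¹) u = s⁻¹ v`. -/
theorem inv_smul_eigenvector_eq {A X : H →L[ℂ] H} (hA : IsStrictlyPositive A)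
    (hX : IsStrictlyPositive X) {v : H} {s : ℝ} (hs : s ≠ 0) (hv : X v = s • v)
    (l : unitInterval) :
    s⁻¹ • v = (l : ℝ) • Ring.inverse X (A (Ring.inverse (pencil A X l) v)) +
      (1 - (l : ℝ)) • Ring.inverse A (A (Ring.inverse (pencil A X l) v)) := by
  have hinv : ∀ {B : H →L[ℂ] H}, IsUnit B → ∀ x, Ring.inverse B (B x) = x := by
    intro B hB x
    rw [← mul_apply_eq_comp, Ring.inverse_mul_cancel _ hB, one_apply_eq_self]
  have h1 : Ring.inverse X v = s⁻¹ • v := by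
    have := hinv hX.isUnit v
    rw [hv, ContinuousLinearMap.map_smul_of_tower] at this
    rw [← this, smul_smul, inv_mul_cancel₀ hs, one_smul, this]
  rw [hinv hA.isUnit, ← h1]
  set y := Ring.inverse (pencil A X l) v
  have hy : v = (l : ℝ) • A y + (1 - (l : ℝ)) • X y := by
    have := inverse_apply_apply (isStrictlyPositive_pencil hA hX l).isUnit v
    rw [← this]
    simp [pencil, y]
  nth_rewrite 1 [hy]
  rw [map_add, ContinuousLinearMap.map_smul_of_tower, ContinuousLinearMap.map_smul_of_tower,
    hinv hX.isUnit]

theorem inv_le_mul_norm_of_bottom_eigenvector {ε a : ℝ} (hε : 0 < ε) (ha : 0 < a)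
    {A X : H →L[ℂ] H} (hA : a • (1 : H →L[ℂ] H) ≤ A) (hX : ε • (1 : H →L[ℂ] H) ≤ X) {v : H}
    (hv1 : ‖v‖ = 1) (hv : X v = ε • v) (l : unitInterval) :
    ε⁻¹ ≤ (l * ε⁻¹ + (1 - l) * a⁻¹) * ‖A (Ring.inverse (pencil A X l) v)‖ := by
  have h := inv_smul_eigenvector_eq (isStrictlyPositive_of_smul_one_le ha hA)
    (isStrictlyPositive_of_smul_one_le hε hX) hε.ne' hv l
  set u := A (Ring.inverse (pencil A X l) v)
  have h1 := congrArg norm h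
  rw [norm_smul, hv1, mul_one, Real.norm_of_nonneg (by positivity)] at h1
  refine h1.le.trans ((norm_add_le _ _).trans ?_)
  rw [norm_smul, norm_smul, Real.norm_of_nonneg l.2.1, Real.norm_of_nonneg (sub_nonneg.2 l.2.2),
    add_mul, mul_assoc, mul_assoc]
  exact add_le_add (mul_le_mul_of_nonneg_left (norm_inverse_apply_le hε hX u) l.2.1)
    (mul_le_mul_of_nonneg_left (norm_inverse_apply_le ha hA u) (sub_nonneg.2 l.2.2))

theorem mul_norm_le_of_top_eigenvector {K b : ℝ} (hK : 0 < K) (hb : 0 < b)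
    {A X : H →L[ℂ] H} (hA : IsStrictlyPositive A) (hX : IsStrictlyPositive X)
    (hAb : A ≤ b • (1 : H →L[ℂ] H)) (hXK : X ≤ K • (1 : H →L[ℂ] H)) {v : H}
    (hv1 : ‖v‖ = 1) (hv : X v = K • v) (l : unitInterval) :
    (l * K⁻¹ + (1 - l) * b⁻¹) * ‖A (Ring.inverse (pencil A X l) v)‖ ≤ K⁻¹ := by
  have h := inv_smul_eigenvector_eq hA hX hK.ne' hv l
  set u := A (Ring.inverse (pencil A X l) v)
  have hle : (l * K⁻¹ + (1 - l) * b⁻¹) • (1 : H →L[ℂ] H) ≤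
      (l : ℝ) • Ring.inverse X + (1 - (l : ℝ)) • Ring.inverse A := by
    rw [add_smul, mul_smul, mul_smul]
    exact add_le_add (smul_le_smul_of_nonneg_left (smul_one_le_inverse hK hX hXK) l.2.1)
      (smul_le_smul_of_nonneg_left (smul_one_le_inverse hb hA hAb) (sub_nonneg.2 l.2.2))
  refine (mul_norm_le_norm_apply hle u).trans (le_of_eq ?_)
  have : ((l : ℝ) • Ring.inverse X + (1 - (l : ℝ)) • Ring.inverse A) u = K⁻¹ • v := by
    rw [h]
    simp
  rw [this, norm_smul, hv1, mul_one, Real.norm_of_nonneg (by positivity)]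

/-- Since `ε < a`, the factor `λ ε⁻¹ + (1 - λ) a⁻¹` is at most `ε⁻¹`, and strictly less for `λ < 1`.
This forces `‖u‖ ≥ 1`, strictly on the open interval. -/
theorem reTrace_gradient_bottom_neg (hμ : μ (Set.Ioo 0 1) ≠ 0) {ε a : ℝ} (hε : 0 < ε)
    (hεa : ε < a) {A X : H →L[ℂ] H} (hA : a • (1 : H →L[ℂ] H) ≤ A)
    (hX : ε • (1 : H →L[ℂ] H) ≤ X) {v : H} (hv1 : ‖v‖ = 1) (hv : X v = ε • v) :
    reTrace H (gradient μ A X * InnerProductSpace.rankOne ℂ v v) < 0 := by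
  have ha := hε.trans hεa
  have hA' := isStrictlyPositive_of_smul_one_le ha hA
  have hX' := isStrictlyPositive_of_smul_one_le hε hX
  rw [reTrace_gradient_mul_rankOne_self μ hA' hX' hv1, ← neg_pos, ← integral_neg]
  have hinv : a⁻¹ < ε⁻¹ := inv_strictAnti₀ hε hεa
  have hε' : 0 < ε⁻¹ := by positivity
  have ha' : 0 < a⁻¹ := by positivity
  have hle : ∀ l : unitInterval, 1 ≤ ‖A (Ring.inverse (pencil A X l) v)‖ := by
    intro l
    have h := inv_le_mul_norm_of_bottom_eigenvector hε ha hA hX hv1 hv l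
    have h2 : l * ε⁻¹ + (1 - l) * a⁻¹ ≤ ε⁻¹ := by nlinarith [l.2.2]
    have := h.trans (mul_le_mul_of_nonneg_right h2 (norm_nonneg _))
    exact (le_mul_iff_one_le_right hε').1 this
  have hcont := continuous_inverse_pencil hA' hX'
  refine integral_pos_of_pos_on_Ioo μ hμ (by fun_prop) (fun l => ?_) fun l hl => ?_
  · nlinarith [l.2.1, hle l, mul_nonneg l.2.1 (by nlinarith [hle l] :
      0 ≤ ‖A (Ring.inverse (pencil A X l) v)‖ ^ 2 - 1)]
  · have h := inv_le_mul_norm_of_bottom_eigenvector hε ha hA hX hv1 hv l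
    have hl0 : (0 : ℝ) < l := hl.1
    have hl1 : (l : ℝ) < 1 := hl.2
    have h1 : 1 < ‖A (Ring.inverse (pencil A X l) v)‖ := by
      refine (hle l).lt_of_ne fun h1 => ?_
      rw [← h1] at h
      nlinarith
    nlinarith [mul_pos hl0 (by nlinarith : 0 < ‖A (Ring.inverse (pencil A X l) v)‖ ^ 2 - 1)]

theorem reTrace_gradient_top_pos (hμ : μ (Set.Ioo 0 1) ≠ 0) {K b : ℝ} (hb : 0 < b)
    (hbK : b < K) {A X : H →L[ℂ] H} (hA : IsStrictlyPositive A) (hX : IsStrictlyPositive X)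
    (hAb : A ≤ b • (1 : H →L[ℂ] H)) (hXK : X ≤ K • (1 : H →L[ℂ] H)) {v : H}
    (hv1 : ‖v‖ = 1) (hv : X v = K • v) :
    0 < reTrace H (gradient μ A X * InnerProductSpace.rankOne ℂ v v) := by
  have hK := hb.trans hbK
  rw [reTrace_gradient_mul_rankOne_self μ hA hX hv1]
  have hinv : K⁻¹ < b⁻¹ := inv_strictAnti₀ hb hbK
  have hK' : 0 < K⁻¹ := by positivity
  have hle : ∀ l : unitInterval, ‖A (Ring.inverse (pencil A X l) v)‖ ≤ 1 := by
    intro l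
    have h := mul_norm_le_of_top_eigenvector hK hb hA hX hAb hXK hv1 hv l
    have h2 : K⁻¹ ≤ l * K⁻¹ + (1 - l) * b⁻¹ := by nlinarith [l.2.2]
    have := (mul_le_mul_of_nonneg_right h2 (norm_nonneg _)).trans h
    exact (mul_le_iff_le_one_right hK').1 this
  have hcont := continuous_inverse_pencil hA hX
  refine integral_pos_of_pos_on_Ioo μ hμ (by fun_prop) (fun l => ?_) fun l hl => ?_
  · exact mul_nonneg l.2.1 (by nlinarith [hle l, norm_nonneg (A (Ring.inverse (pencil A X l) v))])
  · have h := mul_norm_le_of_top_eigenvector hK hb hA hX hAb hXK hv1 hv l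
    have hl0 : (0 : ℝ) < l := hl.1
    have hl1 : (l : ℝ) < 1 := hl.2
    have h1 : ‖A (Ring.inverse (pencil A X l) v)‖ < 1 := by
      refine (hle l).lt_of_ne fun h1 => ?_
      rw [h1] at h
      nlinarith
    exact mul_pos hl0 (by nlinarith [norm_nonneg (A (Ring.inverse (pencil A X l) v))])

/-! ### Existence of a critical point -/

theorem smul_le_of_smul_one_le {δ t : ℝ} {B G : H →L[ℂ] H} (hB : δ • (1 : H →L[ℂ] H) ≤ B)
    (hG : IsSelfAdjoint G) (ht : 0 ≤ t) (h : t * ‖G‖ ≤ δ) : t • G ≤ B :=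
  calc t • G ≤ t • ‖G‖ • (1 : H →L[ℂ] H) := smul_le_smul_of_nonneg_left (le_norm_smul_one hG) ht
    _ = (t * ‖G‖) • (1 : H →L[ℂ] H) := smul_smul _ _ _
    _ ≤ δ • (1 : H →L[ℂ] H) := smul_one_le_smul_one h
    _ ≤ B := hB

theorem isCompact_Icc_smul_one (ε K : ℝ) (hε : 0 < ε) :
    IsCompact (Set.Icc (ε • (1 : H →L[ℂ] H)) (K • 1)) := by
  have : ProperSpace (H →L[ℂ] H) := FiniteDimensional.proper ℂ _
  refine Metric.isCompact_of_isClosed_isBounded isClosed_Icc ?_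
  refine isBounded_iff_forall_norm_le.2 ⟨‖K • (1 : H →L[ℂ] H)‖, fun X hX => ?_⟩
  exact CStarAlgebra.norm_le_norm_of_nonneg_of_le
    (isStrictlyPositive_of_smul_one_le hε hX.1).nonneg hX.2

theorem continuousOn_objective {ε : ℝ} (hε : 0 < ε) (hA : ∀ j, ε • (1 : H →L[ℂ] H) ≤ A j) :
    ContinuousOn (fun X => ∑ j, w j * divergence μ (A j) X) (Set.Ici (ε • (1 : H →L[ℂ] H))) := by
  refine continuousOn_finsetSum _ fun j _ => continuousOn_const.mul ?_
  refine (LipschitzOnWith.of_dist_le_mul (K := Real.toNNReal (‖reTrace H‖ *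
    (|centerOfMass μ| + ‖A j‖ * ε⁻¹ * ε⁻¹ * ‖A j‖))) fun X hX Y hY => ?_).continuousOn
  rw [Real.coe_toNNReal _ (by positivity), Real.dist_eq, dist_eq_norm]
  exact abs_divergence_sub_le μ hε (hA j) hY hX

theorem exists_uniform_bounds (hA : ∀ j, IsStrictlyPositive (A j)) :
    ∃ a b : ℝ, 0 < a ∧ 0 < b ∧ ∀ j, a • (1 : H →L[ℂ] H) ≤ A j ∧ A j ≤ b • (1 : H →L[ℂ] H) := by
  choose e he heA using fun j => exists_smul_one_le (hA j)
  obtain ⟨M, hM⟩ := Finite.exists_le fun j => (e j)⁻¹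
  obtain ⟨N, hN⟩ := Finite.exists_le fun j => ‖A j‖
  have hM' : 0 < max M 1 := lt_max_of_lt_right one_pos
  refine ⟨(max M 1)⁻¹, max N 1, by positivity, lt_max_of_lt_right one_pos, fun j => ⟨?_, ?_⟩⟩
  · exact (smul_one_le_smul_one
      (inv_le_of_inv_le₀ (he j) ((hM j).trans (le_max_left _ _)))).trans (heA j)
  · exact (le_norm_smul_one (hA j).isSelfAdjoint).trans
      (smul_one_le_smul_one ((hN j).trans (le_max_left _ _)))

theorem reTrace_totalGradient_mul (X D : H →L[ℂ] H) :
    reTrace H (totalGradient A w μ X * D) = ∑ j, w j * reTrace H (gradient μ (A j) X * D) := by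
  simp [totalGradient, Finset.sum_mul, map_sum]

theorem exists_totalGradient_eq_zero (hμ : μ (Set.Ioo 0 1) ≠ 0)
    (hA : ∀ j, IsStrictlyPositive (A j)) (hw : ∀ j, 0 < w j) (hw1 : ∑ j, w j = 1) :
    ∃ X : H →L[ℂ] H, IsStrictlyPositive X ∧ totalGradient A w μ X = 0 := by
  have hne := nonempty_of_sum_eq_one hw1
  obtain ⟨a, b, ha, hb, hab⟩ := exists_uniform_bounds hA
  obtain ⟨ε, hε, hεa⟩ := exists_between ha
  -- `K > ε` is imposed separately because `a` and `b` need not be ordered when `H` is trivial.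
  obtain ⟨K, hK⟩ := exists_gt (max b ε)
  have hbK : b < K := (le_max_left _ _).trans_lt hK
  have hεK : ε < K := (le_max_right _ _).trans_lt hK
  have hAε : ∀ j, ε • (1 : H →L[ℂ] H) ≤ A j := fun j =>
    (smul_one_le_smul_one hεa.le).trans (hab j).1
  obtain ⟨X, hX, hmin⟩ := (isCompact_Icc_smul_one (H := H) ε K hε).exists_isMinOn
    ⟨ε • 1, le_rfl, smul_one_le_smul_one hεK.le⟩
    ((continuousOn_objective (w := w) μ hε hAε).mono Set.Icc_subset_Ici_self)
  have hX' := isStrictlyPositive_of_smul_one_le hε hX.1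
  refine ⟨X, hX', ?_⟩
  have hfoc : ∀ (D : H →L[ℂ] H) (t₀ : ℝ), 0 < t₀ →
      (∀ t, 0 ≤ t → t ≤ t₀ → X + t • D ∈ Set.Icc (ε • (1 : H →L[ℂ] H)) (K • 1)) →
      0 ≤ reTrace H (totalGradient A w μ X * D) := fun D t₀ ht₀ hD =>
    reTrace_totalGradient_mul_nonneg μ hε hAε hw ht₀ (fun t h h' => (hD t h h').1)
      fun t h h' => hmin (hD t h h')
  have hlow : 0 ≤ X - ε • 1 := sub_nonneg.2 hX.1
  have hupp : 0 ≤ K • 1 - X := sub_nonneg.2 hX.2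
  have hP : ∀ v : H, 0 ≤ InnerProductSpace.rankOne ℂ v v := fun v =>
    (ContinuousLinearMap.nonneg_iff_isPositive _).2 (InnerProductSpace.isPositive_rankOne_self v)
  -- Otherwise `ε` is an eigenvalue; raising it by at most `K - ε` stays in the interval, against
  -- the negative derivative.
  have hlowu : IsUnit (X - ε • 1) := by
    by_contra hu
    obtain ⟨v, hv1, hv⟩ := exists_unit_eigenvector hu
    have hXv : X v = ε • v := by simpa [sub_eq_zero] using hv
    have h0 := hfoc (InnerProductSpace.rankOne ℂ v v) (K - ε) (sub_pos.2 hεK) fun t ht htt => by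
      refine ⟨hX.1.trans (le_add_of_nonneg_right (smul_nonneg ht (hP v))), ?_⟩
      have h1 : (K - ε) • InnerProductSpace.rankOne ℂ v v ≤ K • 1 - X :=
        smul_rankOne_le hupp hv1 (by simp [hXv, sub_smul])
      have h2 := (smul_le_smul_of_nonneg_right htt (hP v)).trans h1
      rwa [le_sub_iff_add_le'] at h2
    rw [reTrace_totalGradient_mul] at h0
    exact h0.not_gt (Finset.sum_neg (fun j _ => mul_neg_of_pos_of_neg (hw j)
      (reTrace_gradient_bottom_neg μ hμ hε hεa (hab j).1 hX.1 hv1 hXv)) hne)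
  have huppu : IsUnit (K • 1 - X) := by
    by_contra hu
    obtain ⟨v, hv1, hv⟩ := exists_unit_eigenvector hu
    have hXv : X v = K • v := by
      have : K • v - X v = 0 := by simpa using hv
      exact (sub_eq_zero.1 this).symm
    have h0 := hfoc (-InnerProductSpace.rankOne ℂ v v) (K - ε) (sub_pos.2 hεK) fun t ht htt => by
      rw [smul_neg, ← sub_eq_add_neg]
      refine ⟨?_, (sub_le_self _ (smul_nonneg ht (hP v))).trans hX.2⟩
      have h1 : (K - ε) • InnerProductSpace.rankOne ℂ v v ≤ X - ε • 1 :=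
        smul_rankOne_le hlow hv1 (by simp [hXv, sub_smul])
      exact le_sub_comm.1 ((smul_le_smul_of_nonneg_right htt (hP v)).trans h1)
    rw [mul_neg, map_neg, neg_nonneg, reTrace_totalGradient_mul] at h0
    exact h0.not_gt (Finset.sum_pos (fun j _ => mul_pos (hw j)
      (reTrace_gradient_top_pos μ hμ hb hbK (hA j) hX' (hab j).2 hX.2 hv1 hXv)) hne)
  have hG := isSelfAdjoint_totalGradient μ A w hA hX'
  set G := totalGradient A w μ X
  -- `X` is at distance at least `δ` from both ends in the operator order, so short steps along `-G`
  -- are admissible.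
  obtain ⟨δ, hδ, h1, h2⟩ := exists_common_smul_one_le (hlowu.isStrictlyPositive hlow)
    (huppu.isStrictlyPositive hupp)
  have h0 := hfoc (-G) (δ / (‖G‖ + 1)) (by positivity) fun t ht htt => by
    have hts : t * ‖G‖ ≤ δ := by
      rw [le_div_iff₀ (by positivity)] at htt
      nlinarith
    refine ⟨?_, ?_⟩
    · rw [smul_neg, ← sub_eq_add_neg]
      exact le_sub_comm.1 (smul_le_of_smul_one_le h1 hG ht hts)
    · have := smul_le_of_smul_one_le h2 hG.neg ht (by rwa [norm_neg])
      rwa [le_sub_iff_add_le'] at this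
  rw [mul_neg, map_neg, neg_nonneg] at h0
  refine reTrace_star_mul_self_eq_zero (le_antisymm ?_ (reTrace_star_mul_self_nonneg G))
  rwa [hG.star_eq]

end Barycenter

end Hellinger

end

theorem theorem2p1 {H : Type*} [NormedAddCommGroup H] [InnerProductSpace ℂ H]
    [CompleteSpace H] [FiniteDimensional ℂ H]
    (μ : MeasureTheory.Measure unitInterval) [MeasureTheory.IsProbabilityMeasure μ]
    (hμ : μ (Set.Ioo 0 1) ≠ 0)
    {m : ℕ} (A : Fin m → H →L[ℂ] H) (hA : ∀ j, IsStrictlyPositive (A j))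
    (w : Fin m → ℝ) (hw : ∀ j, 0 < w j) (hw1 : ∑ j, w j = 1) :
    ∃ X₀ : H →L[ℂ] H,
      Hellinger.barycenters μ A w = {X₀} ∧
      {X : H →L[ℂ] H | IsStrictlyPositive X ∧ X = Hellinger.fixedPointMap μ A w X} = {X₀} := by
  obtain ⟨X₀, hX₀, h₀⟩ := Hellinger.exists_totalGradient_eq_zero μ hμ hA hw hw1
  have hlt : ∀ {X Y : H →L[ℂ] H}, IsStrictlyPositive X → IsStrictlyPositive Y →
      Hellinger.totalGradient A w μ X = 0 → X ≠ Y →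
      ∑ j, w j * Hellinger.divergence μ (A j) X < ∑ j, w j * Hellinger.divergence μ (A j) Y :=
    fun hX hY h hne =>
      Hellinger.objective_lt_of_totalGradient_eq_zero μ hμ hA hw hw1 hX hY hne h
  refine ⟨X₀, Set.eq_singleton_iff_unique_mem.2 ⟨⟨hX₀, fun Y hY => ?_⟩, fun X hX => ?_⟩,
    Set.eq_singleton_iff_unique_mem.2 ⟨⟨hX₀, ?_⟩, fun X hX => ?_⟩⟩
  · change ∑ j, w j * Hellinger.divergence μ (A j) X₀ ≤ ∑ j, w j * Hellinger.divergence μ (A j) Y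
    rcases eq_or_ne X₀ Y with rfl | hne
    · exact le_rfl
    · exact (hlt hX₀ hY h₀ hne).le
  · by_contra hne
    exact (hlt hX₀ hX.1 h₀ (Ne.symm hne)).not_ge (hX.2 hX₀)
  · exact (Hellinger.eq_fixedPointMap_iff μ A w hμ hA hw1 hX₀).2 h₀
  · by_contra hne
    have hX0 := (Hellinger.eq_fixedPointMap_iff μ A w hμ hA hw1 hX.1).1 hX.2
    -- Two distinct zeros of the gradient would each have a strictly smaller objective than the
    -- other.
    exact lt_asymm (hlt hX₀ hX.1 h₀ (Ne.symm hne)) (hlt hX.1 hX₀ hX0 hne)
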